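/- Let $\Bbbk$ be a field of characteristic zero and let $G$ be an $n$-generator commutator-relators group: $G=F_n/R$, where $F_n=\langle g_1,\dots,g_n\rangle$ is free and $R$ is the normal closure of finitely many elements $r_1,\dots,r_m\in[F_n,F_n]$. Thus $G/G'\cong\mathbb Z^n$ with basis the classes $t_1,\dots,t_n$ of $g_1,\dots,g_n$, and $H^1(G;\Bbbk)=\Bbbk^n$ via $a\mapsto(a(g_1),\dots,a(g_n))$. The first resonance variety of $G$ is $$\mathcal R^1(G)=\{a\in H^1(G;\Bbbk)\mid H^1(A,a)\neq 0\},\qquad A=H^*(G;\Bbbk),$$ where $(A,a)$ is the cochain complex $A^0\to A^1\to A^2\to\cdots$ with differential given by right multiplication by $a$. Let $D=(\partial r_j/\partial g_i)$ be the $n\times m$ Alexander matrix of Fox derivatives of the relators, with entries in $\mathbb Z[G/G']$; its entries lie in the augmentation ideal. Let $D^{(1)}$ be the matrix of linear forms in $S_{\mathbb Z}=\mathbb Z[x_1,\dots,x_n]$ obtained from $D$ by the Magnus embedding $\mathbb Z[G/G']\to\mathbb Z[[x_1,\dots,x_n]]$, $t_i\mapsto 1+x_i$, followed by taking the part of degree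 one. Let $\partial_1\colon S_{\mathbb Z}^n\to S_{\mathbb Z}$, $e_i\mapsto x_i$. The linearized Alexander invariant is $\mathfrak B_{\mathbb Z}=\ker(\partial_1)/\operatorname{im}(D^{(1)})$, and $\mathfrak B=\mathfrak B_{\mathbb Z}\otimes\Bbbk$ is the corresponding module over $S=\Bbbk[x_1,\dots,x_n]$. For an ideal $I\subseteq S$ let $V(I)\subseteq\Bbbk^n$ be its set of common zeros. Then $\mathcal R^1(G)$ and $V(\operatorname{ann}_S\mathfrak B)$ agree away from the origin, $$\mathcal R^1(G)\setminus\{0\}=V(\operatorname{ann}_S\mathfrak B)\setminus\{0\},$$ and if $\mathfrak B\neq 0$, then $$\mathcal R^1(G)=V(\operatorname{ann}_S\mathfrak B).$$ -/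

import Mathlib

universe u v

noncomputable section

open CategoryTheory TensorProduct

/-! ## The first resonance variety of a group -/

section Resonance

variable (k G : Type u) [Field k] [Group G]

/-- `H^0(G; k)`, group cohomology with coefficients in the trivial representation `k`. -/
abbrev CohomZero : Type u := groupCohomology.H0 (Rep.trivial k G k)

/-- `H^1(G; k)`, group cohomology with coefficients in the trivial representation `k`. -/
abbrev CohomOne : Type u := groupCohomology.H1 (Rep.trivial k G k)

/-- `H^2(G; k)`, group cohomology with coefficients in the trivial representation `k`. -/
abbrev CohomTwo : Type u := groupCohomology.H2 (Rep.trivial k G k)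

/-- The identification `H^0(G; k) = k`. -/
def cohomZeroEquiv : CohomZero k G ≃ₗ[k] k :=
  (groupCohomology.H0IsoOfIsTrivial (Rep.trivial k G k)).toLinearEquiv

/-- The identification `H^1(G; k) = Hom(G, k)`, sending the class of a 1-cocycle to itself. -/
def cohomOneEquiv : CohomOne k G ≃ₗ[k] (Additive G →+ k) :=
  (groupCohomology.H1IsoOfIsTrivial (Rep.trivial k G k)).toLinearEquiv

variable {k G}

/-- The cup product of two inhomogeneous 1-cocycles: `(b ∪ a)(g, h) = b(g) a(h)`. -/
def cupCocycle (b a : Additive G →+ k) : groupCohomology.cocycles₂ (Rep.trivial k G k) :=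
  ⟨fun p => b (Additive.ofMul p.1) * a (Additive.ofMul p.2), by
    rw [groupCohomology.mem_cocycles₂_iff]
    intro g h j
    simp only [ofMul_mul, map_add, Representation.isTrivial_apply]
    ring⟩

/-- The cup product `H^1(G; k) × H^1(G; k) → H^2(G; k)`, as the map `b ↦ b ∪ a`. -/
def cupRight (a : CohomOne k G) : CohomOne k G →ₗ[k] CohomTwo k G :=
  (groupCohomology.H2π (Rep.trivial k G k)).hom ∘ₗ
    { toFun := fun b => cupCocycle (cohomOneEquiv k G b) (cohomOneEquiv k G a)
      map_add' := fun b c => by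
        ext g h
        change cohomOneEquiv k G (b + c) (Additive.ofMul g) * _ =
          cohomOneEquiv k G b (Additive.ofMul g) * _ + cohomOneEquiv k G c (Additive.ofMul g) * _
        rw [map_add, AddMonoidHom.add_apply, add_mul]
      map_smul' := fun r b => by
        ext g h
        change cohomOneEquiv k G (r • b) (Additive.ofMul g) * _ =
          r * (cohomOneEquiv k G b (Additive.ofMul g) * _)
        rw [map_smul, ← mul_assoc]
        rfl }

/-- The cup product `H^0(G; k) × H^1(G; k) → H^1(G; k)`, `c ↦ c ∪ a`; on `H^0(G; k) = k` it is
scalar multiplication. -/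
def cupRightZero (a : CohomOne k G) : CohomZero k G →ₗ[k] CohomOne k G :=
  (LinearMap.toSpanSingleton k (CohomOne k G) a) ∘ₗ (cohomZeroEquiv k G).toLinearMap

/-- The two maps `A^0 → A^1 → A^2` given by right multiplication by `a` form a complex. -/
theorem cupRight_comp_cupRightZero [CharZero k] (a : CohomOne k G) :
    cupRight a ∘ₗ cupRightZero a = 0 := by
  have haa : cupRight a a = 0 := by
    change (groupCohomology.H2π (Rep.trivial k G k)).hom _ = 0
    refine (groupCohomology.H2π_eq_zero_iff _).2 ?_
    set f := cohomOneEquiv k G a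
    refine ⟨fun g => -(f (Additive.ofMul g) ^ 2 / 2), ?_⟩
    ext p
    rw [groupCohomology.d₁₂_hom_apply]
    change _ = f (Additive.ofMul p.1) * f (Additive.ofMul p.2)
    simp only [ofMul_mul, map_add, Representation.isTrivial_apply]
    field_simp
    ring
  ext c
  simp [cupRightZero, haa]

/-- `H^1(A, a)` for `A = H^*(G; k)` and `a ∈ A^1`: the cohomology at `A^1` of the cochain complex
`A^0 → A^1 → A^2 → ⋯` whose maps are right multiplication by `a`. -/
abbrev AomotoHOne (a : CohomOne k G) : Type u :=
  LinearMap.ker (cupRight a) ⧸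
    (LinearMap.range (cupRightZero a)).submoduleOf (LinearMap.ker (cupRight a))

variable (k G) in
/-- The first resonance variety `R^1(G) = {a ∈ H^1(G; k) | H^1(H^*(G; k), a) ≠ 0}`. -/
def resonanceVariety : Set (CohomOne k G) := {a | Nontrivial (AomotoHOne a)}

end Resonance

/-! ## Fox calculus -/

section Fox

variable {n : ℕ}

/-- Left multiplication by elements of `F_n` on the additive group of `ℤ[F_n]`. -/
def foxAction (n : ℕ) :
    FreeGroup (Fin n) →* MulAut (Multiplicative (MonoidAlgebra ℤ (FreeGroup (Fin n)))) where
  toFun w :=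
    { toFun := fun x => Multiplicative.ofAdd (MonoidAlgebra.of ℤ _ w * x.toAdd)
      invFun := fun x => Multiplicative.ofAdd (MonoidAlgebra.of ℤ _ w⁻¹ * x.toAdd)
      left_inv := fun x => by
        simp only [toAdd_ofAdd, ← mul_assoc, ← map_mul, inv_mul_cancel, map_one, one_mul,
          ofAdd_toAdd]
      right_inv := fun x => by
        simp only [toAdd_ofAdd, ← mul_assoc, ← map_mul, mul_inv_cancel, map_one, one_mul,
          ofAdd_toAdd]
      map_mul' := fun x y => by simp only [toAdd_mul, mul_add, ofAdd_add] }
  map_one' := by ext x; simp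
  map_mul' w w' := by ext x; simp [← mul_assoc, MonoidAlgebra.single_mul_single]

/-- The homomorphism `w ↦ (∂_i w, w)` from `F_n` to `ℤ[F_n] ⋊ F_n`. -/
def foxHom (i : Fin n) : FreeGroup (Fin n) →*
    Multiplicative (MonoidAlgebra ℤ (FreeGroup (Fin n))) ⋊[foxAction n] FreeGroup (Fin n) :=
  FreeGroup.lift fun j => ⟨Multiplicative.ofAdd (if i = j then 1 else 0), FreeGroup.of j⟩

/-- The Fox free derivative `∂_i = ∂/∂g_i : F_n → ℤ[F_n]`, the unique map with
`∂_i g_j = δ_ij` and `∂_i (u v) = ∂_i u + u ∂_i v`. -/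
def foxDeriv (i : Fin n) (w : FreeGroup (Fin n)) : MonoidAlgebra ℤ (FreeGroup (Fin n)) :=
  (foxHom i w).left.toAdd

theorem foxHom_right (i : Fin n) (w : FreeGroup (Fin n)) : (foxHom i w).right = w := by
  have h : SemidirectProduct.rightHom.comp (foxHom i) = MonoidHom.id _ := by
    ext j; simp [foxHom]
  exact DFunLike.congr_fun h w

theorem foxDeriv_of (i j : Fin n) : foxDeriv i (FreeGroup.of j) = if i = j then 1 else 0 := by
  simp [foxDeriv, foxHom]

theorem foxDeriv_mul (i : Fin n) (u w : FreeGroup (Fin n)) :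
    foxDeriv i (u * w) = foxDeriv i u + MonoidAlgebra.of ℤ _ u * foxDeriv i w := by
  simp only [foxDeriv, map_mul, SemidirectProduct.mul_left, toAdd_mul, foxHom_right]
  rfl

end Fox

/-! ## Commutator-relators presentations and the linearized Alexander invariant -/

/-- An `n`-generator commutator-relators presentation of `G`: a surjection `p : F_n → G` whose
kernel is the normal closure of finitely many elements `r_1, …, r_m` of `[F_n, F_n]`. -/
structure CommutatorRelatorsPresentation (G : Type v) [Group G] (n : ℕ) where
  /-- the projection `F_n → G` -/
  p : FreeGroup (Fin n) →* G
  /-- the number of relators -/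
  m : ℕ
  /-- the relators -/
  rel : Fin m → FreeGroup (Fin n)
  surjective : Function.Surjective p
  ker_eq : p.ker = Subgroup.normalClosure (Set.range rel)
  rel_mem : ∀ j, rel j ∈ commutator (FreeGroup (Fin n))

namespace CommutatorRelatorsPresentation

section

variable {G : Type v} [Group G] {n : ℕ} (P : CommutatorRelatorsPresentation G n)

/-- Every homomorphism from `F_n` to a commutative group kills the kernel of `F_n → G`. -/
theorem ker_le {M : Type*} [CommGroup M] (f : FreeGroup (Fin n) →* M) : P.p.ker ≤ f.ker := by
  rw [P.ker_eq]
  refine Subgroup.normalClosure_le_normal ?_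
  rintro _ ⟨j, rfl⟩
  exact Abelianization.commutator_subset_ker f (P.rel_mem j)

/-- The homomorphism from `G` to a commutative group `M` with prescribed values on the images
`p(g_1), …, p(g_n)` of the generators. -/
def liftComm {M : Type*} [CommGroup M] (f : Fin n → M) : G →* M :=
  P.p.liftOfSurjective P.surjective ⟨FreeGroup.lift f, P.ker_le _⟩

theorem liftComm_p {M : Type*} [CommGroup M] (f : Fin n → M) (w : FreeGroup (Fin n)) :
    P.liftComm f (P.p w) = FreeGroup.lift f w :=
  P.p.liftOfRightInverse_comp_apply _ _ _ _

theorem isUnit_one_add_X (i : Fin n) : IsUnit (1 + MvPowerSeries.X i : MvPowerSeries (Fin n) ℤ) := by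
  rw [MvPowerSeries.isUnit_iff_constantCoeff]
  simp

/-- The Magnus embedding `ψ : ℤ[G/G'] → ℤ[[x_1, …, x_n]]`, given by `ψ(t_i) = 1 + x_i`, where `t_i`
is the class of `p(g_i)` in `G/G'`. -/
def magnus : MonoidAlgebra ℤ (Abelianization G) →ₐ[ℤ] MvPowerSeries (Fin n) ℤ :=
  MonoidAlgebra.lift ℤ _ _ ((Units.coeHom (MvPowerSeries (Fin n) ℤ)).comp
    (Abelianization.lift (P.liftComm fun i => (isUnit_one_add_X i).unit)))

/-- The Alexander matrix: the Fox derivatives `∂_i r_j`, mapped to `ℤ[G/G']`. -/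
def alexanderMatrix : Matrix (Fin n) (Fin P.m) (MonoidAlgebra ℤ (Abelianization G)) :=
  Matrix.of fun i j =>
    MonoidAlgebra.mapDomainRingHom ℤ (Abelianization.of.comp P.p) (foxDeriv i (P.rel j))

/-- The homogeneous part of degree one of a power series, as a linear form in `ℤ[x_1, …, x_n]`. -/
def linearPart (f : MvPowerSeries (Fin n) ℤ) : MvPolynomial (Fin n) ℤ :=
  ∑ l, MvPolynomial.C (MvPowerSeries.coeff (Finsupp.single l 1) f) * MvPolynomial.X l

/-- The linearized Alexander matrix. The entries of the Alexander matrix lie in the augmentation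
ideal, so that modulo `(x_1, …, x_n)^2` their images under the Magnus embedding are linear forms. -/
def linearizedAlexanderMatrix : Matrix (Fin n) (Fin P.m) (MvPolynomial (Fin n) ℤ) :=
  P.alexanderMatrix.map fun f => linearPart (P.magnus f)

/-- The Koszul differential `∂_1 : S^n → S`, `e_i ↦ x_i`, for `S = ℤ[x_1, …, x_n]`. -/
def koszulOne (n : ℕ) :
    (Fin n → MvPolynomial (Fin n) ℤ) →ₗ[MvPolynomial (Fin n) ℤ] MvPolynomial (Fin n) ℤ :=
  Fintype.linearCombination (MvPolynomial (Fin n) ℤ) MvPolynomial.X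

/-- The integral linearized Alexander invariant: `ker ∂_1` modulo the image of the linearized
Alexander matrix (which is contained in `ker ∂_1`), a module over `ℤ[x_1, …, x_n]`. -/
abbrev LinearizedAlexanderInvariantInt : Type :=
  LinearMap.ker (koszulOne n) ⧸
    (LinearMap.range P.linearizedAlexanderMatrix.mulVecLin).submoduleOf (LinearMap.ker (koszulOne n))

end

section

variable {G : Type v} [Group G] {n : ℕ} (P : CommutatorRelatorsPresentation G n)
variable (k : Type u) [Field k]

attribute [local instance] MvPolynomial.algebraMvPolynomial

/-- The linearized Alexander invariant with coefficients in `k`: the extension of scalars of the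
integral one from `ℤ[x_1, …, x_n]` to `k[x_1, …, x_n]`, that is, its tensor product with `k`. -/
def LinearizedAlexanderInvariant : Type u :=
  MvPolynomial (Fin n) k ⊗[MvPolynomial (Fin n) ℤ] P.LinearizedAlexanderInvariantInt

instance : AddCommGroup (P.LinearizedAlexanderInvariant k) :=
  inferInstanceAs (AddCommGroup
    (MvPolynomial (Fin n) k ⊗[MvPolynomial (Fin n) ℤ] P.LinearizedAlexanderInvariantInt))

instance : Module (MvPolynomial (Fin n) k) (P.LinearizedAlexanderInvariant k) :=
  inferInstanceAs (Module (MvPolynomial (Fin n) k)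
    (MvPolynomial (Fin n) k ⊗[MvPolynomial (Fin n) ℤ] P.LinearizedAlexanderInvariantInt))

end

/-- The identification `H^1(G; k) = k^n`, `a ↦ (a(p(g_1)), …, a(p(g_n)))`, that is, the coordinates
with respect to the basis dual to `t_1, …, t_n`. -/
def coordinates {k G : Type u} [Field k] [Group G] {n : ℕ}
    (P : CommutatorRelatorsPresentation G n) : CohomOne k G ≃ₗ[k] (Fin n → k) :=
  cohomOneEquiv k G ≪≫ₗ
    { toFun := fun a i => a (Additive.ofMul (P.p (FreeGroup.of i)))
      map_add' := fun _ _ => rfl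
      map_smul' := fun _ _ => rfl
      invFun := fun c =>
        MonoidHom.toAdditiveLeft (P.liftComm fun i => Multiplicative.ofAdd (c i))
      left_inv := fun a => by
        ext g
        obtain ⟨w, rfl⟩ := P.surjective g
        change Multiplicative.toAdd (P.liftComm _ (P.p w)) = _
        rw [liftComm_p]
        have h : FreeGroup.lift (fun i => Multiplicative.ofAdd
            (a (Additive.ofMul (P.p (FreeGroup.of i))))) =
            (AddMonoidHom.toMultiplicativeRight a).comp P.p := by
          ext i; simp
        exact congrArg Multiplicative.toAdd (DFunLike.congr_fun h w)
      right_inv := fun c => by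
        ext i
        change Multiplicative.toAdd (P.liftComm _ (P.p (FreeGroup.of i))) = _
        rw [liftComm_p]
        simp }

end CommutatorRelatorsPresentation

end

/-! Both varieties are governed by the matrix `D(a)`, the linearized Alexander matrix evaluated at
`a`.

On `F_n` the cocycle `β ∪ α` is a coboundary. Let `c_{li}(w)` be the coefficient of `x_l` in the
Magnus image of `∂_i w`; by the Fox product rule, `-∑ b_l a_i c_{li}` is a primitive. It can be made
to descend to `G` exactly when it vanishes on the relators. Since `c` is antisymmetric on
commutators, this says `b D(a) = 0` (`cupRight_eq_zero_iff_vecMul`). So `a` is resonant iff the left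
kernel of `D(a)` is not contained in the line of `a`; for `a ≠ 0`, duality turns this into: the
range of `D(a)` misses some point of the hyperplane `a · y = 0`.

That condition also describes the support of the invariant. If `s` kills it and `s(a) ≠ 0`, the
Koszul vectors `x_i e_j - x_j e_i`, evaluated at `a`, lie in the range and span the hyperplane
(`mem_zeroLocus_of_notMem_range`). Conversely, if the hyperplane is in the range, some minor of size
`n - 1` is nonzero at `a`, and by Cramer's rule it kills the invariant
(`notMem_zeroLocus_of_forall_mem_range`).

At the origin `D(0) = 0`, so `0` is resonant once `n > 0`. It lies in the zero locus because the
invariant is graded: an annihilator with nonzero constant term forces it to be zero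
(`subsingleton_of_mem_annihilator`). -/

/-- An additive function on a group with values in a commutative group vanishes on commutators. -/
theorem eq_zero_of_mem_commutator {F A : Type*} [Group F] [AddCommGroup A] {f : F → A}
    (hf : ∀ u v, f (u * v) = f u + f v) {w : F} (hw : w ∈ commutator F) : f w = 0 := by
  let φ : F →* Multiplicative A := MonoidHom.mk' (fun w => Multiplicative.ofAdd (f w))
    fun u v => by rw [hf, ofAdd_add]
  exact congrArg Multiplicative.toAdd (Abelianization.commutator_subset_ker φ hw)

/-- Additive functions on a free group that agree on the generators are equal. -/
theorem FreeGroup.eq_of_map_mul_eq_add {α A : Type*} [AddCommGroup A] {f g : FreeGroup α → A}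
    (hf : ∀ u v, f (u * v) = f u + f v) (hg : ∀ u v, g (u * v) = g u + g v)
    (h : ∀ i, f (FreeGroup.of i) = g (FreeGroup.of i)) (w : FreeGroup α) : f w = g w := by
  let φ : FreeGroup α →* Multiplicative A :=
    MonoidHom.mk' (fun w => Multiplicative.ofAdd (f w)) fun u v => by rw [hf, ofAdd_add]
  let ψ : FreeGroup α →* Multiplicative A :=
    MonoidHom.mk' (fun w => Multiplicative.ofAdd (g w)) fun u v => by rw [hg, ofAdd_add]
  have hφψ : φ = ψ := FreeGroup.ext_hom _ _ fun i => congrArg Multiplicative.ofAdd (h i)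
  exact congrArg Multiplicative.toAdd (DFunLike.congr_fun hφψ w)

theorem MvPowerSeries.coeff_single_one_mul {σ R : Type*} [CommSemiring R]
    (l : σ) (f g : MvPowerSeries σ R) :
    MvPowerSeries.coeff (Finsupp.single l 1) (f * g) =
      MvPowerSeries.coeff (Finsupp.single l 1) f * MvPowerSeries.constantCoeff g +
        MvPowerSeries.constantCoeff f * MvPowerSeries.coeff (Finsupp.single l 1) g := by
  classical
  rw [MvPowerSeries.coeff_mul, Finsupp.antidiagonal_single,
    Finset.sum_map, Finset.Nat.sum_antidiagonal_eq_sum_range_succ_mk]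
  simp [Finset.sum_range_succ, add_comm]

/-! ### Fox derivatives up to degree one -/

namespace CommutatorRelatorsPresentation

section Magnus

variable {G : Type*} [Group G] {n : ℕ} (P : CommutatorRelatorsPresentation G n)

/-- The composite `ℤ[F_n] → ℤ[G/G'] → ℤ[[x_1, …, x_n]]` of the projection and the Magnus
embedding. -/
noncomputable def freeMagnus :
    MonoidAlgebra ℤ (FreeGroup (Fin n)) →+* MvPowerSeries (Fin n) ℤ :=
  P.magnus.toRingHom.comp (MonoidAlgebra.mapDomainRingHom ℤ (Abelianization.of.comp P.p))

theorem freeMagnus_of_of (i : Fin n) :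
    P.freeMagnus (MonoidAlgebra.of ℤ _ (FreeGroup.of i)) = 1 + MvPowerSeries.X i := by
  simp only [freeMagnus, magnus, MonoidAlgebra.of_apply, AlgHom.toRingHom_eq_coe,
    RingHom.coe_comp, RingHom.coe_coe, Function.comp_apply, MonoidAlgebra.mapDomainRingHom_apply,
    MonoidAlgebra.mapDomain_single, MonoidAlgebra.lift_single]
  simp [liftComm_p]
  exact one_smul ℤ _

theorem constantCoeff_freeMagnus_of (w : FreeGroup (Fin n)) :
    MvPowerSeries.constantCoeff (P.freeMagnus (MonoidAlgebra.of ℤ _ w)) = 1 := by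
  let φ : FreeGroup (Fin n) →* ℤ := (MvPowerSeries.constantCoeff (σ := Fin n) (R := ℤ)).toMonoidHom.comp
    (P.freeMagnus.toMonoidHom.comp (MonoidAlgebra.of ℤ _))
  -- A monoid homomorphism from a group lands in the units, so it can be compared with `1` on
  -- generators.
  have h : φ.toHomUnits = 1 := FreeGroup.ext_hom _ _ fun i => by
    ext
    change MvPowerSeries.constantCoeff (P.freeMagnus (MonoidAlgebra.of ℤ _ (FreeGroup.of i))) = 1
    rw [freeMagnus_of_of]
    simp
  exact congrArg Units.val (DFunLike.congr_fun h w)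

/-- The exponent sum of `g_i`, as the augmentation of the Fox derivative `∂_i`. -/
noncomputable def exponentSum (i : Fin n) (w : FreeGroup (Fin n)) : ℤ :=
  MvPowerSeries.constantCoeff (P.freeMagnus (foxDeriv i w))

/-- The coefficient of `x_l` in the image of the Fox derivative `∂_i w` under the Magnus
embedding. -/
noncomputable def foxCoeff (l i : Fin n) (w : FreeGroup (Fin n)) : ℤ :=
  MvPowerSeries.coeff (Finsupp.single l 1) (P.freeMagnus (foxDeriv i w))

theorem exponentSum_mul (i : Fin n) (u v : FreeGroup (Fin n)) :
    P.exponentSum i (u * v) = P.exponentSum i u + P.exponentSum i v := by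
  simp only [exponentSum, foxDeriv_mul, map_add, map_mul, constantCoeff_freeMagnus_of, one_mul]

theorem exponentSum_of (i j : Fin n) :
    P.exponentSum i (FreeGroup.of j) = if i = j then 1 else 0 := by
  rw [exponentSum, foxDeriv_of]
  split_ifs <;> simp

/-- Group elements have constant term `1`, so their `x_l`-coefficient is additive under products,
and additive functions are determined on generators. -/
theorem coeff_freeMagnus_of (l : Fin n) (w : FreeGroup (Fin n)) :
    MvPowerSeries.coeff (Finsupp.single l 1) (P.freeMagnus (MonoidAlgebra.of ℤ _ w)) =
      P.exponentSum l w := by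
  classical
  refine FreeGroup.eq_of_map_mul_eq_add (f := fun w => MvPowerSeries.coeff (Finsupp.single l 1)
    (P.freeMagnus (MonoidAlgebra.of ℤ _ w))) (fun u v => ?_) (P.exponentSum_mul l) (fun i => ?_) w
  · rw [map_mul, map_mul, MvPowerSeries.coeff_single_one_mul, constantCoeff_freeMagnus_of,
      constantCoeff_freeMagnus_of, mul_one, one_mul]
  · rw [freeMagnus_of_of, exponentSum_of, map_add, MvPowerSeries.coeff_X, MvPowerSeries.coeff_one]
    simp [Finsupp.single_left_inj]

/-- The rule `∂_i (u v) = ∂_i u + u ∂_i v` read in degree one. The cross term is the cup product of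
two coordinate homomorphisms, so `foxCoeff` is a primitive of it up to sign. -/
theorem foxCoeff_mul (l i : Fin n) (u v : FreeGroup (Fin n)) :
    P.foxCoeff l i (u * v) =
      P.foxCoeff l i u + P.foxCoeff l i v + P.exponentSum l u * P.exponentSum i v := by
  rw [foxCoeff, foxDeriv_mul, map_add, map_add, map_mul, MvPowerSeries.coeff_single_one_mul,
    coeff_freeMagnus_of, constantCoeff_freeMagnus_of, one_mul]
  simp only [foxCoeff, exponentSum]
  ring

theorem exponentSum_eq_zero (i : Fin n) {w : FreeGroup (Fin n)}
    (hw : w ∈ commutator (FreeGroup (Fin n))) : P.exponentSum i w = 0 :=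
  eq_zero_of_mem_commutator (P.exponentSum_mul i) hw

/-- A shuffle relation: `c_{li} + c_{il} - ε_l ε_i`, with `ε` the exponent sums, is additive and so
dies on commutators, as do the `ε` themselves. -/
theorem foxCoeff_swap (l i : Fin n) {w : FreeGroup (Fin n)}
    (hw : w ∈ commutator (FreeGroup (Fin n))) : P.foxCoeff l i w = -P.foxCoeff i l w := by
  have h := eq_zero_of_mem_commutator
    (f := fun w => P.foxCoeff l i w + P.foxCoeff i l w - P.exponentSum l w * P.exponentSum i w)
    (fun u v => by simp only [foxCoeff_mul, exponentSum_mul]; ring) hw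
  simp only [P.exponentSum_eq_zero _ hw] at h
  linarith

theorem linearizedAlexanderMatrix_apply (i : Fin n) (j : Fin P.m) :
    P.linearizedAlexanderMatrix i j =
      ∑ l, MvPolynomial.C (P.foxCoeff l i (P.rel j)) * MvPolynomial.X l :=
  rfl

/-- The columns of the linearized Alexander matrix lie in the kernel of `∂_1`. -/
theorem koszulOne_mulVec (v : Fin P.m → MvPolynomial (Fin n) ℤ) :
    koszulOne n (P.linearizedAlexanderMatrix.mulVec v) = 0 := by
  have hcol (j : Fin P.m) : ∑ i, MvPolynomial.X i * P.linearizedAlexanderMatrix i j = 0 := by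
    -- Antisymmetry of the coefficients makes this quadratic form its own negative, and `ℤ[x]` has
    -- no 2-torsion.
    have hx : ∑ i, MvPolynomial.X i * P.linearizedAlexanderMatrix i j =
        -∑ i, MvPolynomial.X i * P.linearizedAlexanderMatrix i j := by
      simp only [linearizedAlexanderMatrix_apply, Finset.mul_sum]
      conv_lhs => rw [Finset.sum_comm]
      rw [← Finset.sum_neg_distrib]
      refine Finset.sum_congr rfl fun i _ => ?_
      rw [← Finset.sum_neg_distrib]
      refine Finset.sum_congr rfl fun l _ => ?_
      rw [P.foxCoeff_swap i l (P.rel_mem j), map_neg]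
      ring
    exact self_eq_neg.1 hx
  have : koszulOne n (P.linearizedAlexanderMatrix.mulVec v) =
      ∑ j, (∑ i, MvPolynomial.X i * P.linearizedAlexanderMatrix i j) * v j := by
    simp only [koszulOne, Fintype.linearCombination_apply, Matrix.mulVec, dotProduct, smul_eq_mul,
      Finset.sum_mul]
    rw [Finset.sum_comm]
    exact Finset.sum_congr rfl fun j _ => Finset.sum_congr rfl fun i _ => by ring
  rw [this]
  simp [hcol]

/-- The value at `a` of the linearized Alexander matrix. -/
noncomputable def evalMatrix {k : Type*} [CommRing k] (a : Fin n → k) : Matrix (Fin n) (Fin P.m) k :=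
  P.linearizedAlexanderMatrix.map (MvPolynomial.aeval a)

theorem evalMatrix_apply {k : Type*} [CommRing k] (a : Fin n → k) (i : Fin n) (j : Fin P.m) :
    P.evalMatrix a i j = ∑ l, (P.foxCoeff l i (P.rel j) : k) * a l := by
  simp [evalMatrix, linearizedAlexanderMatrix_apply]

end Magnus

end CommutatorRelatorsPresentation

/-! ### Cup products and the left kernel of the evaluated matrix -/

/-- The cup product `β ∪ α` vanishes if and only if the 2-cocycle `(g, h) ↦ β(g) α(h)` is a
coboundary. -/
theorem cupRight_eq_zero_iff {k G : Type u} [Field k] [Group G] (α β : CohomOne k G) :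
    cupRight α β = 0 ↔ ∃ f : G → k, ∀ g h, f (g * h) = f g + f h -
      cohomOneEquiv k G β (Additive.ofMul g) * cohomOneEquiv k G α (Additive.ofMul h) := by
  change (groupCohomology.H2π (Rep.trivial k G k)).hom
    (cupCocycle (cohomOneEquiv k G β) (cohomOneEquiv k G α)) = 0 ↔ _
  refine (groupCohomology.H2π_eq_zero_iff _).trans ?_
  refine exists_congr fun f => ?_
  rw [funext_iff, Prod.forall]
  refine forall_congr' fun g => forall_congr' fun h => ?_
  rw [groupCohomology.d₁₂_hom_apply]
  change f h - f (g * h) + f g =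
    cohomOneEquiv k G β (Additive.ofMul g) * cohomOneEquiv k G α (Additive.ofMul h) ↔ _
  constructor <;> intro e <;> linear_combination -e

namespace CommutatorRelatorsPresentation

section

variable {k : Type*} {G : Type*} [Field k] [Group G] {n : ℕ}
  (P : CommutatorRelatorsPresentation G n)

/-- The combination `∑ b_l a_i c_{l i}` of the second-order Fox coefficients `c_{l i}`. -/
noncomputable def foxForm (b a : Fin n → k) (w : FreeGroup (Fin n)) : k :=
  ∑ l, ∑ i, b l * a i * P.foxCoeff l i w

theorem foxForm_mul (b a : Fin n → k) (u w : FreeGroup (Fin n)) :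
    P.foxForm b a (u * w) = P.foxForm b a u + P.foxForm b a w +
      (∑ l, b l * P.exponentSum l u) * ∑ i, a i * P.exponentSum i w := by
  simp only [foxForm, foxCoeff_mul, Finset.sum_mul_sum, ← Finset.sum_add_distrib]
  refine Finset.sum_congr rfl fun l _ => Finset.sum_congr rfl fun i _ => ?_
  push_cast
  ring

/-- The form pairs `b` with the first index of `c`, the matrix product with the second; exchanging
them on a relator costs the sign. -/
theorem foxForm_rel (b a : Fin n → k) (j : Fin P.m) :
    P.foxForm b a (P.rel j) = -Matrix.vecMul b (P.evalMatrix a) j := by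
  simp only [foxForm, Matrix.vecMul, dotProduct, evalMatrix_apply, Finset.mul_sum,
    ← Finset.sum_neg_distrib]
  refine Finset.sum_congr rfl fun l _ => Finset.sum_congr rfl fun i _ => ?_
  rw [P.foxCoeff_swap l i (P.rel_mem j)]
  push_cast
  ring

theorem apply_eq_sum_exponentSum (f : Additive G →+ k) (w : FreeGroup (Fin n)) :
    f (Additive.ofMul (P.p w)) =
      ∑ i, f (Additive.ofMul (P.p (FreeGroup.of i))) * P.exponentSum i w := by
  refine FreeGroup.eq_of_map_mul_eq_add
    (f := fun w => f (Additive.ofMul (P.p w)))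
    (g := fun w => ∑ i, f (Additive.ofMul (P.p (FreeGroup.of i))) * P.exponentSum i w)
    (fun u w => by rw [map_mul, ofMul_mul, map_add]) (fun u w => ?_) (fun i => ?_) w
  · rw [← Finset.sum_add_distrib]
    refine Finset.sum_congr rfl fun i _ => ?_
    rw [exponentSum_mul]
    push_cast
    ring
  · simp [exponentSum_of]

/-- A function on `F_n` that is additive up to a product of homomorphisms pulled back from `G`, and
that vanishes on the relators, vanishes on the kernel of `F_n → G`. -/
theorem eq_zero_of_mem_ker {T : FreeGroup (Fin n) → k} {β α : Additive G →+ k}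
    (hT : ∀ u w, T (u * w) =
      T u + T w + β (Additive.ofMul (P.p u)) * α (Additive.ofMul (P.p w)))
    (hrel : ∀ j, T (P.rel j) = 0) {w : FreeGroup (Fin n)} (hw : P.p w = 1) : T w = 0 := by
  have hone : T 1 = 0 := by simpa using hT 1 1
  have hl {u w : FreeGroup (Fin n)} (hu : P.p u = 1) : T (u * w) = T u + T w := by
    simp [hT, hu]
  have hr {u w : FreeGroup (Fin n)} (hw : P.p w = 1) : T (u * w) = T u + T w := by
    simp [hT, hw]
  -- `T` is additive as soon as one factor is in the kernel, because the cross term then contains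
  -- `β` or `α` of the identity.
  let N : Subgroup (FreeGroup (Fin n)) :=
    { carrier := {w | P.p w = 1 ∧ T w = 0}
      mul_mem' := fun {u w} hu hw => ⟨by rw [map_mul, hu.1, hw.1, one_mul], by
        rw [hl hu.1, hu.2, hw.2, add_zero]⟩
      one_mem' := ⟨map_one _, hone⟩
      inv_mem' := fun {u} hu => ⟨by rw [map_inv, hu.1, inv_one], by
        have h := hl (w := u⁻¹) hu.1
        rw [mul_inv_cancel, hone, hu.2, zero_add] at h
        exact h.symm⟩ }
  have hN : N.Normal := ⟨fun w hw u => ⟨by rw [map_mul, map_mul, hw.1, mul_one, ← map_mul,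
    mul_inv_cancel, map_one], by
      -- For `w` in `N`, the value of `T` at `u w u⁻¹` reduces to its value at `u u⁻¹ = 1`.
      have h1 := hT u u⁻¹
      rw [mul_inv_cancel, hone] at h1
      rw [hT, hr hw.1, hw.2, add_zero, map_mul, hw.1, mul_one, ← h1]⟩⟩
  have hle : P.p.ker ≤ N := by
    rw [P.ker_eq]
    refine Subgroup.normalClosure_le_normal ?_
    rintro _ ⟨j, rfl⟩
    refine ⟨?_, hrel j⟩
    rw [← MonoidHom.mem_ker, P.ker_eq]
    exact Subgroup.subset_normalClosure ⟨j, rfl⟩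
  exact (hle hw).2

end

variable {k G : Type u} [Field k] [Group G] {n : ℕ} (P : CommutatorRelatorsPresentation G n)

theorem cohomOneEquiv_apply_p (α : CohomOne k G) (w : FreeGroup (Fin n)) :
    cohomOneEquiv k G α (Additive.ofMul (P.p w)) =
      ∑ i, P.coordinates α i * P.exponentSum i w :=
  P.apply_eq_sum_exponentSum _ w

/-- The kernel of right multiplication by `α` on `H^1(G; k) = k^n` is the left kernel of the
linearized Alexander matrix evaluated at `α`. -/
theorem cupRight_eq_zero_iff_vecMul (α β : CohomOne k G) :
    cupRight α β = 0 ↔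
      Matrix.vecMul (P.coordinates β) (P.evalMatrix (P.coordinates α)) = 0 := by
  rw [cupRight_eq_zero_iff]
  have hform := P.foxForm_mul (P.coordinates β) (P.coordinates α)
  simp only [← cohomOneEquiv_apply_p] at hform
  constructor
  · rintro ⟨f, hf⟩
    ext j
    have hone : f 1 = 0 := by simpa using hf 1 1
    -- `f ∘ p` and `foxForm` have opposite defects of additivity, so their sum is additive and
    -- vanishes on relators.
    have h := eq_zero_of_mem_commutator
      (f := fun w => f (P.p w) + P.foxForm (P.coordinates β) (P.coordinates α) w)
      (fun u w => by simp only [hform, map_mul, hf]; ring) (P.rel_mem j)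
    have hp : P.p (P.rel j) = 1 := by
      rw [← MonoidHom.mem_ker, P.ker_eq]
      exact Subgroup.subset_normalClosure ⟨j, rfl⟩
    rw [Pi.zero_apply]
    simpa only [hp, hone, zero_add, foxForm_rel, neg_eq_zero] using h
  · intro h
    have hker {w : FreeGroup (Fin n)} (hw : P.p w = 1) :
        P.foxForm (P.coordinates β) (P.coordinates α) w = 0 :=
      P.eq_zero_of_mem_ker hform (fun j => by rw [foxForm_rel, h, Pi.zero_apply, neg_zero]) hw
    -- Writing `u = (u w⁻¹) w` with `u w⁻¹` in the kernel shows that the form factors through `G`;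
    -- the section below is then an arbitrary choice of lifts.
    have hwd {u w : FreeGroup (Fin n)} (huw : P.p u = P.p w) :
        P.foxForm (P.coordinates β) (P.coordinates α) u =
          P.foxForm (P.coordinates β) (P.coordinates α) w := by
      have h1 : P.p (u * w⁻¹) = 1 := by rw [map_mul, map_inv, huw, mul_inv_cancel]
      have h2 := hform (u * w⁻¹) w
      rw [inv_mul_cancel_right, hker h1, h1] at h2
      simpa using h2
    refine ⟨fun g => -P.foxForm (P.coordinates β) (P.coordinates α)
      (Function.surjInv P.surjective g), fun g g' => ?_⟩
    have hs := Function.surjInv_eq P.surjective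
    beta_reduce
    rw [hwd (u := Function.surjInv P.surjective (g * g'))
      (w := Function.surjInv P.surjective g * Function.surjInv P.surjective g')
      (by simp only [map_mul, hs]), hform, hs, hs]
    ring

/-- A point `α` of `H^1(G; k)` is resonant if and only if some vector in the left kernel of the
linearized Alexander matrix evaluated at `α` is not a multiple of `α`. -/
theorem mem_resonanceVariety_iff (α : CohomOne k G) :
    α ∈ resonanceVariety k G ↔ ∃ b : Fin n → k,
      Matrix.vecMul b (P.evalMatrix (P.coordinates α)) = 0 ∧
        b ∉ Submodule.span k {P.coordinates α} := by
  have hrange : LinearMap.range (cupRightZero α) = Submodule.span k {α} := by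
    rw [cupRightZero, LinearMap.range_comp, LinearEquiv.range, Submodule.map_top,
      LinearMap.range_toSpanSingleton]
  have hspan (β : CohomOne k G) : β ∈ Submodule.span k {α} ↔
      P.coordinates β ∈ Submodule.span k {P.coordinates α} := by
    simp only [Submodule.mem_span_singleton, ← map_smul, P.coordinates.injective.eq_iff]
  change Nontrivial (AomotoHOne α) ↔ _
  rw [Submodule.Quotient.nontrivial_iff, Ne, Submodule.submoduleOf_eq_top, hrange,
    SetLike.not_le_iff_exists]
  constructor
  · rintro ⟨β, h1, h2⟩
    exact ⟨P.coordinates β, (P.cupRight_eq_zero_iff_vecMul α β).1 h1, mt (hspan β).2 h2⟩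
  · rintro ⟨b, h1, h2⟩
    obtain ⟨β, rfl⟩ := P.coordinates.surjective b
    exact ⟨β, (P.cupRight_eq_zero_iff_vecMul α β).2 h1, mt (hspan β).1 h2⟩

end CommutatorRelatorsPresentation

/-! ### Graded polynomials, flatness and linear algebra -/

open scoped TensorProduct

namespace MvPolynomial

variable {σ R : Type*} [CommSemiring R]

theorem homogeneousComponent_mul_of_isHomogeneous_left {d : ℕ} {p : MvPolynomial σ R}
    (hp : p.IsHomogeneous d) (q : MvPolynomial σ R) (e : ℕ) :
    homogeneousComponent (d + e) (p * q) = p * homogeneousComponent e q := by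
  let := gradedAlgebra (σ := σ) (R := R)
  have h := DirectSum.coe_decompose_mul_add_of_left_mem (homogeneousSubmodule σ R) (j := e) (b := q)
    ((mem_homogeneousSubmodule d p).2 hp)
  rwa [← decomposition.decompose'_apply, ← decomposition.decompose'_apply]

theorem IsHomogeneous.homogeneousComponent_mul_left {d : ℕ} {p : MvPolynomial σ R}
    (hp : p.IsHomogeneous d) (q : MvPolynomial σ R) :
    homogeneousComponent d (q * p) = constantCoeff q • p := by
  have h := homogeneousComponent_mul_of_isHomogeneous_left hp q 0
  rw [add_zero, homogeneousComponent_zero] at h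
  rw [mul_comm, h, mul_comm, smul_eq_C_mul]
  rfl

/-- `k[σ]` is flat over `ℤ[σ]` for a field `k` of characteristic zero. -/
theorem flat_int {k : Type*} [Field k] [CharZero k] :
    letI := algebraMvPolynomial (σ := σ) (R := ℤ) (S := k)
    Module.Flat (MvPolynomial σ ℤ) (MvPolynomial σ k) :=
  letI := algebraMvPolynomial (σ := σ) (R := ℤ) (S := k)
  -- In characteristic zero `k` is torsion-free, hence flat, over `ℤ`, and `k[σ]` is its base change
  -- to `ℤ[σ]`.
  Module.Flat.isBaseChange (R := ℤ) (M := k) (S := MvPolynomial σ ℤ) (N := MvPolynomial σ k)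
    (Algebra.IsPushout.out (R := ℤ) (S := MvPolynomial σ ℤ) (R' := k) (S' := MvPolynomial σ k))

end MvPolynomial

/-- A matrix with surjective `mulVec` has an invertible maximal square submatrix. -/
theorem Matrix.exists_isUnit_submatrix_of_surjective {I J k : Type*} [Fintype I] [DecidableEq I]
    [Fintype J] [Field k] (M : Matrix I J k) (hM : Function.Surjective M.mulVec) :
    ∃ e : I → J, IsUnit (M.submatrix id e) := by
  obtain ⟨κ, a, -, hspan, hli⟩ := exists_linearIndependent' k M.col
  have htop : ⊤ ≤ Submodule.span k (Set.range (M.col ∘ a)) := by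
    rw [hspan, ← Matrix.range_mulVecLin]
    exact (LinearMap.range_eq_top.2 hM).ge
  let B := Module.Basis.mk hli htop
  let e : I ≃ κ := (Pi.basisFun k I).indexEquiv B
  refine ⟨a ∘ e, Matrix.linearIndependent_cols_iff_isUnit.1 ?_⟩
  exact hli.comp e e.injective

/-- For `a ≠ 0`, the left kernel of `M` is contained in the line spanned by `a` if and only if
the range of `M` contains the kernel of the linear form `a`. -/
theorem Matrix.exists_vecMul_eq_zero_notMem_span_iff {ι J k : Type*} [Fintype ι] [DecidableEq ι]
    [Fintype J] [Field k] (M : Matrix ι J k) {a : ι → k} (ha : a ≠ 0) :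
    (∃ b, Matrix.vecMul b M = 0 ∧ b ∉ Submodule.span k {a}) ↔
      ∃ y, a ⬝ᵥ y = 0 ∧ y ∉ LinearMap.range M.mulVecLin := by
  constructor
  · rintro ⟨b, hb, hba⟩
    by_contra! hcon
    obtain ⟨i, hi⟩ := Function.ne_iff.1 ha
    refine hba (Submodule.mem_span_singleton.2 ⟨b i / a i, ?_⟩)
    ext j
    -- Pairing `b` with a preimage of `a_i e_j - a_j e_i` gives `a_i b_j = a_j b_i`, so `b` is
    -- proportional to `a`.
    obtain ⟨v, hv⟩ := hcon (a i • Pi.single j 1 - a j • Pi.single i 1) (by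
      simp [dotProduct_sub, dotProduct_smul, mul_comm])
    have h : b ⬝ᵥ (M.mulVec v) = 0 := by rw [Matrix.dotProduct_mulVec, hb, zero_dotProduct]
    rw [← Matrix.mulVecLin_apply, hv] at h
    simp only [dotProduct_sub, dotProduct_smul, dotProduct_single, mul_one, smul_eq_mul] at h
    have hi' : a i ≠ 0 := hi
    simp only [Pi.smul_apply, smul_eq_mul]
    field_simp
    linear_combination -h
  · rintro ⟨y, hy, hyM⟩
    -- The coordinate vector of a functional separating `y` from the range is the required `b`: a
    -- multiple of `a` would vanish on `y`.
    obtain ⟨f, hf, hle⟩ := Submodule.exists_le_ker_of_notMem hyM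
    let b : ι → k := fun i => f (Pi.single i 1)
    have hfb (z : ι → k) : f z = b ⬝ᵥ z := by
      conv_lhs => rw [pi_eq_sum_univ' z, map_sum]
      refine Finset.sum_congr rfl fun i _ => ?_
      rw [map_smul, smul_eq_mul, mul_comm]
    refine ⟨b, ?_, fun hb => ?_⟩
    · classical
      ext j
      have h : f (M.mulVecLin (Pi.single j 1)) = 0 := hle ⟨_, rfl⟩
      rw [hfb, Matrix.mulVecLin_apply, Matrix.dotProduct_mulVec] at h
      simpa using h
    · obtain ⟨c, hc⟩ := Submodule.mem_span_singleton.1 hb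
      refine hf ?_
      rw [hfb, ← hc, smul_dotProduct, hy, smul_zero]

/-! ### The annihilator away from the origin -/

namespace CommutatorRelatorsPresentation

variable {G : Type v} [Group G] {n : ℕ} (P : CommutatorRelatorsPresentation G n)

theorem mem_ker_koszulOne {v : Fin n → MvPolynomial (Fin n) ℤ} :
    v ∈ LinearMap.ker (koszulOne n) ↔ ∑ i, v i * MvPolynomial.X i = 0 := by
  rw [LinearMap.mem_ker, koszulOne, Fintype.linearCombination_apply]
  rfl

theorem map_mulVec_mem_range {T : Type*} [CommRing T] (φ : MvPolynomial (Fin n) ℤ →+* T)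
    {v : Fin n → MvPolynomial (Fin n) ℤ}
    (hv : v ∈ LinearMap.range P.linearizedAlexanderMatrix.mulVecLin) :
    (fun i => φ (v i)) ∈ LinearMap.range (P.linearizedAlexanderMatrix.map φ).mulVecLin := by
  obtain ⟨w, rfl⟩ := hv
  refine ⟨fun j => φ (w j), ?_⟩
  ext i
  exact (RingHom.map_mulVec φ _ w i).symm

section

variable {k : Type u} [Field k]

attribute [local instance] MvPolynomial.algebraMvPolynomial

/-- The class of an integral vector of `ker ∂_1` in the linearized Alexander invariant. -/
noncomputable def invariantClass (k : Type u) [Field k] (v : LinearMap.ker (koszulOne n)) :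
    P.LinearizedAlexanderInvariant k :=
  (1 : MvPolynomial (Fin n) k) ⊗ₜ[MvPolynomial (Fin n) ℤ] Submodule.Quotient.mk v

theorem algebraMap_smul_invariantClass (r : MvPolynomial (Fin n) ℤ)
    (v : LinearMap.ker (koszulOne n)) :
    algebraMap (MvPolynomial (Fin n) ℤ) (MvPolynomial (Fin n) k) r • P.invariantClass k v =
      P.invariantClass k (r • v) := by
  have h := TensorProduct.smul_tmul (R := MvPolynomial (Fin n) ℤ) r (1 : MvPolynomial (Fin n) k)
    (Submodule.Quotient.mk v : P.LinearizedAlexanderInvariantInt)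
  rw [Algebra.smul_def] at h
  exact h

theorem invariantClass_of_mem_range (v : LinearMap.ker (koszulOne n))
    (hv : v.1 ∈ LinearMap.range P.linearizedAlexanderMatrix.mulVecLin) :
    P.invariantClass k v = 0 :=
  (congrArg (fun b => (1 : MvPolynomial (Fin n) k) ⊗ₜ[MvPolynomial (Fin n) ℤ] b)
    ((Submodule.Quotient.mk_eq_zero ((LinearMap.range
      P.linearizedAlexanderMatrix.mulVecLin).submoduleOf _)).2 hv)).trans (TensorProduct.tmul_zero _ _)

theorem invariant_induction {C : P.LinearizedAlexanderInvariant k → Prop} (h0 : C 0)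
    (hadd : ∀ x y, C x → C y → C (x + y)) (h : ∀ (p : MvPolynomial (Fin n) k) v, C (p • P.invariantClass k v))
    (x : P.LinearizedAlexanderInvariant k) : C x := by
  refine TensorProduct.induction_on x h0 (fun p b => ?_) hadd
  obtain ⟨v, rfl⟩ := Submodule.Quotient.mk_surjective _ b
  have e : p • P.invariantClass k v =
      p ⊗ₜ[MvPolynomial (Fin n) ℤ] Submodule.Quotient.mk v := by
    refine (TensorProduct.smul_tmul' p _ _).trans ?_
    rw [smul_eq_mul, mul_one]
  exact e ▸ h p v

/-- If `s` annihilates the linearized Alexander invariant, then over every `k[x_1, …, x_n]`-algebra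
it multiplies the vectors of `ker ∂_1` into the range of the linearized Alexander matrix. -/
theorem smul_mem_range_of_mem_annihilator {T : Type*} [CommRing T]
    (φ : MvPolynomial (Fin n) k →+* T) {s : MvPolynomial (Fin n) k}
    (hs : s ∈ Module.annihilator (MvPolynomial (Fin n) k) (P.LinearizedAlexanderInvariant k))
    (v : LinearMap.ker (koszulOne n)) :
    φ s • (fun i => φ (MvPolynomial.map (Int.castRingHom k) (v.1 i))) ∈
      LinearMap.range (P.linearizedAlexanderMatrix.map
        (φ.comp (MvPolynomial.map (Int.castRingHom k)))).mulVecLin := by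
  set ψ := φ.comp (MvPolynomial.map (σ := Fin n) (Int.castRingHom k)) with hψ
  set N := LinearMap.range (P.linearizedAlexanderMatrix.map ψ).mulVecLin
  -- Applying `ψ` entrywise modulo `N` kills the columns, so it descends to the integral invariant
  -- and extends to an additive map `F` on the tensor product. Applying `F` to `s ⊗ v = 0` gives the
  -- claim.
  let g₀ : LinearMap.ker (koszulOne n) →ₛₗ[ψ] (Fin n → T) ⧸ N :=
    { toFun := fun v => Submodule.Quotient.mk fun i => ψ (v.1 i)
      map_add' := fun v w => by
        rw [← Submodule.Quotient.mk_add]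
        congr 1
        ext i
        simp
      map_smul' := fun r v => by
        rw [← Submodule.Quotient.mk_smul]
        congr 1
        ext i
        simp }
  let g : P.LinearizedAlexanderInvariantInt →ₛₗ[ψ] (Fin n → T) ⧸ N :=
    Submodule.liftQ _ g₀ fun v hv =>
      (Submodule.Quotient.mk_eq_zero _).2 (P.map_mulVec_mem_range ψ hv)
  let f : MvPolynomial (Fin n) k →+ P.LinearizedAlexanderInvariantInt →+ (Fin n → T) ⧸ N :=
    { toFun := fun p => (smulAddHom T _ (φ p)).comp g.toAddMonoidHom
      map_zero' := by ext; simp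
      map_add' := fun p q => by ext; simp }
  let F : MvPolynomial (Fin n) k ⊗[MvPolynomial (Fin n) ℤ] P.LinearizedAlexanderInvariantInt →+
      (Fin n → T) ⧸ N := TensorProduct.liftAddHom f fun r p b => by
    change φ (r • p) • g b = φ p • g (r • b)
    rw [g.map_smulₛₗ, smul_smul, Algebra.smul_def, map_mul, mul_comm]
    rfl
  have h : s ⊗ₜ[MvPolynomial (Fin n) ℤ] (Submodule.Quotient.mk v : P.LinearizedAlexanderInvariantInt)
      = 0 := by
    refine Eq.trans ?_ (Module.mem_annihilator.1 hs (P.invariantClass k v))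
    symm
    refine (TensorProduct.smul_tmul' s _ _).trans ?_
    rw [smul_eq_mul, mul_one]
  have h' : φ s • g (Submodule.Quotient.mk v) = 0 := by
    have := congrArg F h
    rwa [map_zero] at this
  rw [← Submodule.Quotient.mk_eq_zero, Submodule.Quotient.mk_smul]
  exact h'

/-- If the linear form `a ≠ 0` has a zero outside of the range of the linearized Alexander matrix
evaluated at `a`, then `a` is a common zero of the annihilator. -/
theorem mem_zeroLocus_of_notMem_range {a : Fin n → k} (ha : a ≠ 0) {y : Fin n → k}
    (hy : a ⬝ᵥ y = 0) (hyM : y ∉ LinearMap.range (P.evalMatrix a).mulVecLin) :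
    a ∈ MvPolynomial.zeroLocus k (Module.annihilator (MvPolynomial (Fin n) k)
      (P.LinearizedAlexanderInvariant k)) := by
  intro s hs
  by_contra hsa
  refine hyM ?_
  obtain ⟨i, hi⟩ := Function.ne_iff.1 ha
  have hi' : a i ≠ 0 := hi
  have hcomp : (MvPolynomial.aeval a).toRingHom.comp (MvPolynomial.map (Int.castRingHom k)) =
      (MvPolynomial.aeval (R := ℤ) a).toRingHom := by
    ext j <;> simp
  have key (v : LinearMap.ker (koszulOne n)) :
      (fun i => MvPolynomial.aeval a (v.1 i)) ∈ LinearMap.range (P.evalMatrix a).mulVecLin := by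
    have h := P.smul_mem_range_of_mem_annihilator (MvPolynomial.aeval a).toRingHom hs v
    rw [hcomp] at h
    have h' := (Submodule.smul_mem_iff _ hsa).1 h
    have e : (fun i => MvPolynomial.aeval a (v.1 i)) = fun i =>
        (MvPolynomial.aeval a).toRingHom (MvPolynomial.map (Int.castRingHom k) (v.1 i)) :=
      funext fun i => (DFunLike.congr_fun hcomp (v.1 i)).symm
    rw [e]
    exact h'
  have hpair (j : Fin n) : a i • Pi.single j 1 - a j • Pi.single i 1 ∈
      LinearMap.range (P.evalMatrix a).mulVecLin := by
    have hker : Pi.single j (MvPolynomial.X i) - Pi.single i (MvPolynomial.X j) ∈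
        LinearMap.ker (koszulOne n) := by
      rw [LinearMap.mem_ker, map_sub, koszulOne, Fintype.linearCombination_apply_single,
        Fintype.linearCombination_apply_single, smul_eq_mul, smul_eq_mul, mul_comm, sub_self]
    convert key ⟨_, hker⟩ using 1
    ext l
    simp only [Pi.sub_apply, Pi.smul_apply, Pi.single_apply, smul_eq_mul]
    split_ifs <;> simp
  -- The `e_i` terms add up to a multiple of `a · y = 0`, so the evaluated Koszul vectors span the
  -- hyperplane.
  have hsum : y = ∑ j, (y j / a i) • (a i • Pi.single j 1 - a j • Pi.single i (1 : k)) := by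
    ext l
    simp only [Finset.sum_apply, Pi.smul_apply, Pi.sub_apply, smul_eq_mul, mul_sub,
      Finset.sum_sub_distrib]
    have h1 : ∑ j, y j / a i * (a i * (Pi.single j 1 : Fin n → k) l) = y l := by
      rw [Finset.sum_eq_single l]
      · rw [Pi.single_eq_same]; field_simp
      · intro j _ hj
        rw [Pi.single_eq_of_ne hj.symm]; simp
      · simp
    have h2 : ∑ j, y j / a i * (a j * (Pi.single i 1 : Fin n → k) l) = 0 := by
      have : ∑ j, y j / a i * (a j * (Pi.single i 1 : Fin n → k) l) =
          (a ⬝ᵥ y) * ((Pi.single i 1 : Fin n → k) l / a i) := by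
        rw [dotProduct, Finset.sum_mul]
        exact Finset.sum_congr rfl fun j _ => by ring
      rw [this, hy, zero_mul]
    rw [h1, h2, sub_zero]
  rw [hsum]
  exact Submodule.sum_mem _ fun j _ => Submodule.smul_mem _ _ (hpair j)

/-- If `a ≠ 0` and the range of the linearized Alexander matrix evaluated at `a` contains the
kernel of the linear form `a`, then `a` is not a common zero of the annihilator. -/
theorem notMem_zeroLocus_of_forall_mem_range {a : Fin n → k} (ha : a ≠ 0)
    (hM : ∀ y, a ⬝ᵥ y = 0 → y ∈ LinearMap.range (P.evalMatrix a).mulVecLin) :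
    a ∉ MvPolynomial.zeroLocus k (Module.annihilator (MvPolynomial (Fin n) k)
      (P.LinearizedAlexanderInvariant k)) := by
  obtain ⟨i, hi⟩ := Function.ne_iff.1 ha
  have hi' : a i ≠ 0 := hi
  set D := P.linearizedAlexanderMatrix with hD
  let I := {j : Fin n // j ≠ i}
  -- Since `a_i ≠ 0`, any values off `i` extend to a point of the hyperplane by adjusting coordinate
  -- `i`. Hence `D(a)` without row `i` is surjective and has an invertible maximal minor.
  have hsurj : Function.Surjective ((P.evalMatrix a).submatrix (Subtype.val : I → Fin n) id).mulVec := by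
    intro z
    let z' : Fin n → k := fun j => if h : j ≠ i then z ⟨j, h⟩ else 0
    obtain ⟨v, hv⟩ := hM (z' - ((a ⬝ᵥ z') / a i) • Pi.single i 1) (by
      simp only [dotProduct_sub, dotProduct_smul, dotProduct_single, mul_one, smul_eq_mul]
      field_simp
      ring)
    refine ⟨v, ?_⟩
    ext j
    have h := congrFun hv j.1
    refine Eq.trans h ?_
    simp [z', j.2]
  obtain ⟨e, he⟩ := Matrix.exists_isUnit_submatrix_of_surjective _ hsurj
  let M : Matrix I I (MvPolynomial (Fin n) ℤ) := D.submatrix Subtype.val e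
  have hdet : MvPolynomial.aeval a M.det ≠ 0 := by
    rw [AlgHom.map_det]
    exact ((Matrix.isUnit_iff_isUnit_det _).1 he).ne_zero
  have hann (v : LinearMap.ker (koszulOne n)) :
      M.det • v.1 ∈ LinearMap.range D.mulVecLin := by
    let E : Matrix (Fin P.m) I (MvPolynomial (Fin n) ℤ) :=
      (1 : Matrix (Fin P.m) (Fin P.m) (MvPolynomial (Fin n) ℤ)).submatrix id e
    let v' : I → MvPolynomial (Fin n) ℤ := fun j => v.1 j
    have hDE : (D * E).submatrix Subtype.val id = M := by
      rw [show D * E = D.submatrix id e from Matrix.mul_submatrix_one (Equiv.refl _) e D]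
      rfl
    refine ⟨E.mulVec (M.adjugate.mulVec v'), ?_⟩
    -- The adjugate matches `det M • v` on all rows but `i`. The difference `w` is still in `ker
    -- ∂_1`, so `x_i w_i = 0` and `w_i` vanishes as well.
    set w := M.det • v.1 - D.mulVec (E.mulVec (M.adjugate.mulVec v')) with hw
    have hwker : w ∈ LinearMap.ker (koszulOne n) := by
      rw [LinearMap.mem_ker, hw, map_sub, P.koszulOne_mulVec, sub_zero, map_smul,
        LinearMap.mem_ker.1 v.2, smul_zero]
    have hwj (j : Fin n) (hj : j ≠ i) : w j = 0 := by
      have h : D.mulVec (E.mulVec (M.adjugate.mulVec v')) j = M.det * v.1 j := by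
        rw [Matrix.mulVec_mulVec]
        change ((D * E).submatrix (Subtype.val : I → Fin n) id).mulVec (M.adjugate.mulVec v')
          ⟨j, hj⟩ = _
        rw [hDE, Matrix.mulVec_mulVec, Matrix.mul_adjugate, Matrix.smul_mulVec, Matrix.one_mulVec]
        rfl
      rw [hw, Pi.sub_apply, h, Pi.smul_apply, smul_eq_mul, sub_self]
    have hwi : w i = 0 := by
      rw [mem_ker_koszulOne, Finset.sum_eq_single i (fun j _ hj => by rw [hwj j hj, zero_mul])
        (by simp)] at hwker
      exact (mul_eq_zero.1 hwker).resolve_right (MvPolynomial.X_ne_zero i)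
    have hw0 : w = 0 := by
      ext1 j
      by_cases hj : j = i
      · rw [hj, hwi, Pi.zero_apply]
      · rw [hwj j hj, Pi.zero_apply]
    exact (sub_eq_zero.1 hw0).symm
  intro hmem
  refine hdet ?_
  have h := hmem (algebraMap (MvPolynomial (Fin n) ℤ) (MvPolynomial (Fin n) k) M.det) ?_
  · rw [MvPolynomial.algebraMap_def, MvPolynomial.aeval_map_algebraMap] at h
    exact h
  · rw [Module.mem_annihilator]
    refine P.invariant_induction (smul_zero _)
      (fun x y hx hy => by rw [smul_add, hx, hy, add_zero]) (fun p v => ?_)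
    rw [smul_comm]
    rw [P.algebraMap_smul_invariantClass, P.invariantClass_of_mem_range _ (hann v), smul_zero]

/-! ### The grading and the origin -/

/-- A vector of `ker ∂_1` that lies over `k` in the range of the linearized Alexander matrix has
class zero. -/
theorem invariantClass_eq_zero [CharZero k] (v : LinearMap.ker (koszulOne n))
    (hv : (fun i => MvPolynomial.map (Int.castRingHom k) (v.1 i)) ∈ LinearMap.range
      (P.linearizedAlexanderMatrix.map (MvPolynomial.map (Int.castRingHom k))).mulVecLin) :
    P.invariantClass k v = 0 := by
  have : Module.Flat (MvPolynomial (Fin n) ℤ) (MvPolynomial (Fin n) k) := MvPolynomial.flat_int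
  set N := LinearMap.range P.linearizedAlexanderMatrix.mulVecLin with hN
  -- The integral invariant embeds in the cokernel of the full matrix, and flatness keeps this
  -- embedding injective over `k`; vanishing can thus be tested in the cokernel.
  let ι : P.LinearizedAlexanderInvariantInt →ₗ[MvPolynomial (Fin n) ℤ]
      (Fin n → MvPolynomial (Fin n) ℤ) ⧸ N :=
    Submodule.mapQ _ N (LinearMap.ker (koszulOne n)).subtype le_rfl
  have hι : Function.Injective ι := by
    rw [← LinearMap.ker_eq_bot]
    refine (Submodule.ker_mapQ _ _ _ _).trans ?_
    exact Submodule.mkQ_map_self _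
  apply Module.Flat.lTensor_preserves_injective_linearMap
    (M := MvPolynomial (Fin n) k) ι hι
  refine Eq.trans ?_ (map_zero _).symm
  let c (v : Fin n → MvPolynomial (Fin n) ℤ) :
      MvPolynomial (Fin n) k ⊗[MvPolynomial (Fin n) ℤ] ((Fin n → MvPolynomial (Fin n) ℤ) ⧸ N) :=
    1 ⊗ₜ Submodule.Quotient.mk v
  change c v.1 = 0
  have hc (v : Fin n → MvPolynomial (Fin n) ℤ) :
      c v = ∑ i, MvPolynomial.map (Int.castRingHom k) (v i) • c (Pi.single i 1) := by
    have h1 : v = ∑ i, v i • Pi.single i 1 := by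
      ext1 l; simp [Finset.sum_apply, Pi.single_apply]
    have h2 : (Submodule.Quotient.mk v : (Fin n → MvPolynomial (Fin n) ℤ) ⧸ N) =
        ∑ i, v i • Submodule.Quotient.mk (Pi.single i 1) := by
      conv_lhs => rw [h1]
      exact map_sum N.mkQ _ _
    change 1 ⊗ₜ _ = _
    rw [h2, TensorProduct.tmul_sum]
    refine Finset.sum_congr rfl fun i _ => ?_
    rw [← TensorProduct.smul_tmul, TensorProduct.smul_tmul', Algebra.smul_def]
    rfl
  have hcol (j : Fin P.m) : ∑ i, MvPolynomial.map (Int.castRingHom k)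
      (P.linearizedAlexanderMatrix i j) • c (Pi.single i 1) = 0 := by
    rw [← hc fun i => P.linearizedAlexanderMatrix i j]
    change 1 ⊗ₜ _ = _
    rw [(Submodule.Quotient.mk_eq_zero N).2, TensorProduct.tmul_zero]
    refine ⟨Pi.single j 1, ?_⟩
    ext1 i
    simp
  obtain ⟨u, hu⟩ := hv
  rw [hc]
  have hui (i : Fin n) : MvPolynomial.map (Int.castRingHom k) (v.1 i) = ∑ j, u j *
      MvPolynomial.map (Int.castRingHom k) (P.linearizedAlexanderMatrix i j) := by
    rw [← congrFun hu i]
    refine Eq.trans (b := ∑ j, MvPolynomial.map (Int.castRingHom k)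
      (P.linearizedAlexanderMatrix i j) * u j) rfl ?_
    exact Finset.sum_congr rfl fun j _ => mul_comm _ _
  simp only [hui, Finset.sum_smul, mul_smul]
  rw [Finset.sum_comm]
  simp only [← Finset.smul_sum, hcol, smul_zero, Finset.sum_const_zero]

theorem isHomogeneous_linearizedAlexanderMatrix (i : Fin n) (j : Fin P.m) :
    (P.linearizedAlexanderMatrix i j).IsHomogeneous 1 := by
  rw [linearizedAlexanderMatrix_apply]
  refine MvPolynomial.IsHomogeneous.sum _ _ _ fun l _ => ?_
  exact (MvPolynomial.isHomogeneous_X ℤ l).C_mul _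

/-- The homogeneous components of a vector of polynomials in the range of the linearized Alexander
matrix lie in the range. -/
theorem homogeneousComponent_mem_range {y : Fin n → MvPolynomial (Fin n) k}
    (hy : y ∈ LinearMap.range
      (P.linearizedAlexanderMatrix.map (MvPolynomial.map (Int.castRingHom k))).mulVecLin) (d : ℕ) :
    (fun i => MvPolynomial.homogeneousComponent d (y i)) ∈ LinearMap.range
      (P.linearizedAlexanderMatrix.map (MvPolynomial.map (Int.castRingHom k))).mulVecLin := by
  obtain ⟨u, rfl⟩ := hy
  have hhom (i j) : (MvPolynomial.map (Int.castRingHom k)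
      (P.linearizedAlexanderMatrix i j)).IsHomogeneous 1 :=
    (P.isHomogeneous_linearizedAlexanderMatrix i j).map _
  cases d with
  | zero =>
    convert Submodule.zero_mem _ using 1
    ext1 i
    rw [MvPolynomial.homogeneousComponent_zero, Pi.zero_apply, MvPolynomial.C_eq_zero]
    change MvPolynomial.constantCoeff (∑ j, MvPolynomial.map (Int.castRingHom k)
      (P.linearizedAlexanderMatrix i j) * u j) = 0
    rw [map_sum]
    refine Finset.sum_eq_zero fun j _ => ?_
    rw [map_mul, MvPolynomial.constantCoeff_eq, (hhom i j).coeff_eq_zero (by simp), zero_mul]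
  | succ d =>
    refine ⟨fun j => MvPolynomial.homogeneousComponent d (u j), ?_⟩
    ext1 i
    change ∑ j, MvPolynomial.map (Int.castRingHom k) (P.linearizedAlexanderMatrix i j) *
      MvPolynomial.homogeneousComponent d (u j) = MvPolynomial.homogeneousComponent (d + 1)
      (∑ j, MvPolynomial.map (Int.castRingHom k) (P.linearizedAlexanderMatrix i j) * u j)
    rw [map_sum, add_comm]
    exact Finset.sum_congr rfl fun j _ =>
      (MvPolynomial.homogeneousComponent_mul_of_isHomogeneous_left (hhom i j) _ _).symm

/-- The homogeneous components of a vector of `ker ∂_1` lie in `ker ∂_1`. -/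
theorem homogeneousComponent_mem_ker_koszulOne {v : Fin n → MvPolynomial (Fin n) ℤ}
    (hv : v ∈ LinearMap.ker (koszulOne n)) (d : ℕ) :
    (fun i => MvPolynomial.homogeneousComponent d (v i)) ∈ LinearMap.ker (koszulOne n) := by
  rw [mem_ker_koszulOne] at hv ⊢
  have h := congrArg (MvPolynomial.homogeneousComponent (1 + d)) hv
  rw [map_sum, map_zero] at h
  rw [← h]
  refine Finset.sum_congr rfl fun i _ => ?_
  rw [mul_comm (v i), MvPolynomial.homogeneousComponent_mul_of_isHomogeneous_left
    (MvPolynomial.isHomogeneous_X ℤ i), mul_comm]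

/-- If some polynomial in the annihilator does not vanish at the origin, then the linearized
Alexander invariant is zero, because it is graded. -/
theorem subsingleton_of_mem_annihilator [CharZero k] {s : MvPolynomial (Fin n) k}
    (hs : s ∈ Module.annihilator (MvPolynomial (Fin n) k) (P.LinearizedAlexanderInvariant k))
    (hs0 : MvPolynomial.constantCoeff s ≠ 0) :
    Subsingleton (P.LinearizedAlexanderInvariant k) := by
  set N := LinearMap.range
    (P.linearizedAlexanderMatrix.map (MvPolynomial.map (Int.castRingHom k))).mulVecLin with hN
  -- If `v_d` is the degree `d` part of `v`, the degree `d` part of `s v_d` is `s(0) v_d`. It lies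
  -- in the range, since the matrix has linear entries, and `s(0)` is invertible.
  have hcomp (v : Fin n → MvPolynomial (Fin n) ℤ) (hv : v ∈ LinearMap.ker (koszulOne n)) (d : ℕ) :
      (fun i => MvPolynomial.map (Int.castRingHom k)
        (MvPolynomial.homogeneousComponent d (v i))) ∈ N := by
    have h := P.homogeneousComponent_mem_range
      (P.smul_mem_range_of_mem_annihilator (RingHom.id _) hs
        ⟨_, homogeneousComponent_mem_ker_koszulOne hv d⟩) d
    have h2 : MvPolynomial.C (σ := Fin n) (MvPolynomial.constantCoeff s)⁻¹ • (MvPolynomial.constantCoeff s •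
        fun i => MvPolynomial.map (Int.castRingHom k)
          (MvPolynomial.homogeneousComponent d (v i))) ∈ N := by
      refine Submodule.smul_mem _ _ ?_
      convert h using 1
      ext1 i
      exact (((MvPolynomial.homogeneousComponent_isHomogeneous d (v i)).map
        (Int.castRingHom k)).homogeneousComponent_mul_left s).symm
    convert h2 using 1
    ext1 i
    simp only [Pi.smul_apply, smul_eq_mul, MvPolynomial.smul_eq_C_mul]
    rw [← mul_assoc, ← map_mul, inv_mul_cancel₀ hs0, map_one, one_mul]
  have hclass (v : LinearMap.ker (koszulOne n)) : P.invariantClass k v = 0 := by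
    refine P.invariantClass_eq_zero v ?_
    let K := Finset.univ.sup fun i => (v.1 i).totalDegree
    have hsum : (fun i => MvPolynomial.map (Int.castRingHom k) (v.1 i)) =
        ∑ d ∈ Finset.range (K + 1), fun i => MvPolynomial.map (Int.castRingHom k)
          (MvPolynomial.homogeneousComponent d (v.1 i)) := by
      ext1 i
      rw [Finset.sum_apply, ← map_sum]
      congr 1
      conv_lhs => rw [← MvPolynomial.sum_homogeneousComponent (v.1 i)]
      refine Finset.sum_subset (Finset.range_mono (Nat.succ_le_succ
        (Finset.le_sup (f := fun i => (v.1 i).totalDegree) (Finset.mem_univ i)))) fun d _ hd => ?_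
      refine MvPolynomial.homogeneousComponent_eq_zero _ _ ?_
      simpa using hd
    rw [hsum]
    exact Submodule.sum_mem _ fun d _ => hcomp v.1 v.2 d
  have hzero : ∀ x : P.LinearizedAlexanderInvariant k, x = 0 :=
    P.invariant_induction rfl (fun x y hx hy => by rw [hx, hy, add_zero])
      fun p v => by rw [hclass, smul_zero]
  exact ⟨fun x y => (hzero x).trans (hzero y).symm⟩

theorem pos_of_nontrivial [CharZero k] [h : Nontrivial (P.LinearizedAlexanderInvariant k)] : 0 < n := by
  by_contra hn
  obtain rfl : n = 0 := by omega
  refine not_subsingleton (P.LinearizedAlexanderInvariant k)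
    (P.subsingleton_of_mem_annihilator (s := 1) ?_ (by simp))
  rw [Module.mem_annihilator]
  refine P.invariant_induction (smul_zero _)
    (fun x y hx hy => by rw [smul_add, hx, hy, add_zero]) (fun p v => ?_)
  rw [P.invariantClass_of_mem_range v ⟨0, Subsingleton.elim _ _⟩, smul_zero, smul_zero]

end

end CommutatorRelatorsPresentation

theorem mainTheorem7 {k G : Type u} [Field k] [CharZero k] [Group G] {n : ℕ}
    (P : CommutatorRelatorsPresentation G n) :
    (P.coordinates '' resonanceVariety k G) \ {0} =
        MvPolynomial.zeroLocus k
          (Module.annihilator (MvPolynomial (Fin n) k) (P.LinearizedAlexanderInvariant k)) \ {0} ∧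
      (Nontrivial (P.LinearizedAlexanderInvariant k) →
        P.coordinates '' resonanceVariety k G =
          MvPolynomial.zeroLocus k
            (Module.annihilator (MvPolynomial (Fin n) k)
              (P.LinearizedAlexanderInvariant k))) := by
  have himage (a : Fin n → k) : a ∈ P.coordinates '' resonanceVariety k G ↔
      ∃ b, Matrix.vecMul b (P.evalMatrix a) = 0 ∧ b ∉ Submodule.span k {a} := by
    obtain ⟨α, rfl⟩ := P.coordinates.surjective a
    rw [P.coordinates.injective.mem_set_image, P.mem_resonanceVariety_iff]
  have hne (a : Fin n → k) (ha : a ≠ 0) : a ∈ P.coordinates '' resonanceVariety k G ↔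
      a ∈ MvPolynomial.zeroLocus k
        (Module.annihilator (MvPolynomial (Fin n) k) (P.LinearizedAlexanderInvariant k)) := by
    rw [himage, Matrix.exists_vecMul_eq_zero_notMem_span_iff _ ha]
    constructor
    · rintro ⟨y, hy, hyM⟩
      exact P.mem_zeroLocus_of_notMem_range ha hy hyM
    · intro h
      by_contra! hcon
      exact P.notMem_zeroLocus_of_forall_mem_range ha hcon h
  refine ⟨?_, fun hB => ?_⟩
  · ext a
    exact and_congr_left fun ha => hne a ha
  · ext a
    by_cases ha : a = 0
    · subst ha
      refine iff_of_true ((himage 0).2 ?_) fun s hs => ?_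
      -- At the origin the matrix is zero and the line of `a` is trivial, so any nonzero `b` serves;
      -- the all-ones vector is nonzero because `n > 0`.
      · refine ⟨fun _ => 1, ?_, fun h => ?_⟩
        · have h0 : P.evalMatrix (0 : Fin n → k) = 0 := by
            ext i j
            simp [P.evalMatrix_apply]
          rw [h0, Matrix.vecMul_zero]
        · rw [Submodule.span_zero_singleton, Submodule.mem_bot] at h
          exact one_ne_zero (congrFun h ⟨0, P.pos_of_nontrivial (k := k)⟩)
      · by_contra hs0
        refine not_subsingleton (P.LinearizedAlexanderInvariant k)
          (P.subsingleton_of_mem_annihilator hs ?_)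
        simpa [MvPolynomial.aeval_zero] using hs0
    · exact hne a ha
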